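/- Let $\Gamma$ be a finitely generated group and let $(F_n)_n$ be a (right) Følner sequence in $\Gamma$, i.e. a sequence of non-empty finite subsets $F_n \subset \Gamma$ with $\lim_{n\to\infty} |F_n\gamma \setminus F_n| / |F_n| = 0$ for every $\gamma \in \Gamma$ (so that $\Gamma$ is amenable). Let $\mathcal{N}\Gamma$ be the group von Neumann algebra, i.e. the algebra of bounded operators on $L^2(\Gamma)$ which commute with left multiplication by all elements of $\Gamma$, with the canonical trace $\tau(A) = (Ae, e)$, where $e \in \Gamma \subset L^2(\Gamma)$ is the unit element. For invertible $A \in \mathcal{N}\Gamma$ put $\det_{\mathcal{N}\Gamma} A = \exp \tau(\log |A|)$, where $|A| = (A^*A)^{1/2}$, and for arbitrary $A \in \mathcal{N}\Gamma$ let $\det_{\mathcal{N}\Gamma} A = \lim_{\varepsilon \to 0+} \det_{\mathcal{N}\Gamma}(|A| + \varepsilon)$ be the Fuglede--Kadison determinant. For a finite subset $F \subset \Gamma$ let $A_F = p_F A i_F$ be the compression of $A$ to an endomorphism of $\mathbb{C}F \subset L^2(\Gamma)$, where $i_F : \mathbb{C}F \hookrightarrow L^2(\Gamma)$ is the inclusion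 and $p_F : L^2(\Gamma) \to \mathbb{C}F$ the orthogonal projection. Then for every positive operator $A \in \mathcal{N}\Gamma$ (positive meaning self-adjoint with $(Ax,x) \ge 0$ for all $x$; then $\det A_{F_n} \ge 0$ for all $n$) we have $$\det\nolimits_{\mathcal{N}\Gamma} A \;\ge\; \limsup_{n\to\infty} \,(\det A_{F_n})^{1/|F_n|}.$$ -/

import Mathlib

open Filter Topology
open scoped ENNReal

/-! ### The Fuglede--Kadison determinant -/

noncomputable section FugledeKadison

/-- The positive functional `A ↦ (A ξ, ξ)` on bounded operators. Mathlib's inner product is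
linear in the second argument. -/
def vectorTrace {H : Type*} [NormedAddCommGroup H] [InnerProductSpace ℂ H]
    (ξ : H) (A : H →L[ℂ] H) : ℂ :=
  inner ℂ ξ (A ξ)

/-- The determinant `exp τ(log |A|)` of an invertible operator `A`, with respect to a trace `τ`.
Since `log |A|` is self-adjoint, `τ(log |A|)` is real for the traces considered here. -/
def fkDetInvertible {H : Type*} [NormedAddCommGroup H] [InnerProductSpace ℂ H] [CompleteSpace H]
    (τ : (H →L[ℂ] H) → ℂ) (A : H →L[ℂ] H) : ℝ :=
  Real.exp (τ (CFC.log (CFC.abs A))).re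

/-- The Fuglede--Kadison determinant of an arbitrary operator `A`, with respect to a trace `τ`:
the limit of the determinants of `|A| + ε` for `ε → 0+`. -/
def fkDet {H : Type*} [NormedAddCommGroup H] [InnerProductSpace ℂ H] [CompleteSpace H]
    (τ : (H →L[ℂ] H) → ℂ) (A : H →L[ℂ] H) : ℝ :=
  limUnder (𝓝[>] (0 : ℝ)) fun ε : ℝ =>
    fkDetInvertible τ (CFC.abs A + algebraMap ℝ (H →L[ℂ] H) ε)

theorem isStrictlyPositive_abs_add {H : Type*} [NormedAddCommGroup H] [InnerProductSpace ℂ H]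
    [CompleteSpace H] (A : H →L[ℂ] H) {ε : ℝ} (hε : 0 < ε) :
    IsStrictlyPositive (CFC.abs A + algebraMap ℝ (H →L[ℂ] H) ε) :=
  (IsStrictlyPositive.nonneg_add (CFC.abs_nonneg A)
    (isStrictlyPositive_algebraMap hε))

/-- The limit in the definition of the Fuglede--Kadison determinant exists. -/
theorem tendsto_fkDet {H : Type*} [NormedAddCommGroup H] [InnerProductSpace ℂ H]
    [CompleteSpace H] (ξ : H) (A : H →L[ℂ] H) :
    Tendsto (fun ε : ℝ => fkDetInvertible (vectorTrace ξ)
        (CFC.abs A + algebraMap ℝ (H →L[ℂ] H) ε))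
      (𝓝[>] 0) (𝓝 (fkDet (vectorTrace ξ) A)) := by
  have hmono : MonotoneOn (fun ε : ℝ => fkDetInvertible (vectorTrace ξ)
      (CFC.abs A + algebraMap ℝ (H →L[ℂ] H) ε)) (Set.Ioi 0) := by
    intro ε hε δ hδ hεδ
    have h1 := isStrictlyPositive_abs_add A (Set.mem_Ioi.mp hε)
    have h2 := isStrictlyPositive_abs_add A (Set.mem_Ioi.mp hδ)
    have hle : CFC.abs A + algebraMap ℝ (H →L[ℂ] H) ε
        ≤ CFC.abs A + algebraMap ℝ (H →L[ℂ] H) δ := by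
      gcongr
    have hlog := CFC.log_monotoneOn h1 h2 hle
    simp only [fkDetInvertible]
    rw [CFC.abs_of_nonneg _ h1.nonneg, CFC.abs_of_nonneg _ h2.nonneg]
    refine Real.exp_le_exp.mpr ?_
    have hp := (ContinuousLinearMap.le_def _ _).mp hlog
    have h3 := hp.re_inner_nonneg_right ξ
    simp only [sub_apply, inner_sub_right, map_sub] at h3
    simpa [vectorTrace] using h3
  have hbdd : BddBelow ((fun ε : ℝ => fkDetInvertible (vectorTrace ξ)
      (CFC.abs A + algebraMap ℝ (H →L[ℂ] H) ε)) '' Set.Ioi 0) := by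
    refine ⟨0, ?_⟩
    rintro _ ⟨ε, -, rfl⟩
    exact (Real.exp_pos _).le
  exact tendsto_nhds_limUnder ⟨_, hmono.tendsto_nhdsGT hbdd⟩

end FugledeKadison

/-! ### The group von Neumann algebra -/

noncomputable section GroupVonNeumann

/-- The complex Hilbert space `L²(Γ)` of square summable functions on the discrete group `Γ`. -/
abbrev GroupL2 (Γ : Type*) : Type _ := lp (fun _ : Γ => ℂ) 2

namespace GroupL2

open Classical in
/-- The element `γ ∈ Γ ⊂ L²(Γ)`, i.e. the indicator function of `{γ}`. -/
def basisVec {Γ : Type*} (γ : Γ) : GroupL2 Γ := lp.single 2 γ (1 : ℂ)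

theorem memlp_comp {Γ : Type*} (e : Γ ≃ Γ) (x : GroupL2 Γ) :
    Memℓp (fun h => (x (e h) : ℂ)) 2 := by
  have h2 : 0 < (2 : ℝ≥0∞).toReal := by norm_num
  rw [memℓp_gen_iff h2]
  exact ((memℓp_gen_iff h2).mp (lp.memℓp x)).comp_injective e.injective

/-- Left multiplication by `γ` on `L²(Γ)`: `γ (∑ x_h h) = ∑ x_h γh`, so that the coefficient of
`γ x` at `h` is the coefficient of `x` at `γ⁻¹ h`. -/
def leftMul {Γ : Type*} [Group Γ] (γ : Γ) : GroupL2 Γ ≃ₗᵢ[ℂ] GroupL2 Γ where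
  toFun x := ⟨fun h => x (γ⁻¹ * h), memlp_comp (Equiv.mulLeft γ⁻¹) x⟩
  invFun x := ⟨fun h => x (γ * h), memlp_comp (Equiv.mulLeft γ) x⟩
  left_inv x := by ext h; simp
  right_inv x := by ext h; simp
  map_add' _ _ := rfl
  map_smul' _ _ := rfl
  norm_map' x := by
    have h2 : 0 < (2 : ℝ≥0∞).toReal := by norm_num
    rw [lp.norm_eq_tsum_rpow h2, lp.norm_eq_tsum_rpow h2]
    congr 1
    exact (Equiv.mulLeft γ⁻¹).tsum_eq (fun h => ‖x h‖ ^ (2 : ℝ≥0∞).toReal)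

/-- Left multiplication by `γ` as a bounded operator. -/
def leftMulL {Γ : Type*} [Group Γ] (γ : Γ) : GroupL2 Γ →L[ℂ] GroupL2 Γ :=
  (leftMul γ).toContinuousLinearEquiv

@[simp]
theorem leftMulL_apply {Γ : Type*} [Group Γ] (γ : Γ) (x : GroupL2 Γ) (h : Γ) :
    leftMulL γ x h = x (γ⁻¹ * h) := rfl

theorem star_leftMulL {Γ : Type*} [Group Γ] (γ : Γ) :
    star (leftMulL γ) = leftMulL γ⁻¹ := by
  have h : star (leftMulL γ) = ((leftMul γ).symm.toContinuousLinearEquiv :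
      GroupL2 Γ →L[ℂ] GroupL2 Γ) := (leftMul γ).adjoint_eq_symm
  rw [h]
  ext x k
  change x (γ * k) = x (γ⁻¹⁻¹ * k)
  rw [inv_inv]

theorem leftMulL_basisVec {Γ : Type*} [Group Γ] (γ h : Γ) :
    leftMulL γ (basisVec h) = basisVec (γ * h) := by
  ext k
  simp only [leftMulL_apply, basisVec, lp.single_apply, Pi.single_apply]
  by_cases hk : k = γ * h
  · rw [if_pos hk, if_pos (inv_mul_eq_iff_eq_mul.mpr hk)]
  · rw [if_neg hk, if_neg (fun h' => hk (inv_mul_eq_iff_eq_mul.mp h'))]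

end GroupL2

open GroupL2

/-- The group von Neumann algebra `𝓝Γ`: the bounded operators on `L²(Γ)` which are equivariant
for the left action of `Γ`. -/
def groupVonNeumannAlgebra (Γ : Type*) [Group Γ] : VonNeumannAlgebra (GroupL2 Γ) where
  toStarSubalgebra :=
    { carrier := {A | ∀ γ : Γ, A * leftMulL γ = leftMulL γ * A}
      mul_mem' := fun {A B} hA hB γ => by rw [mul_assoc, hB, ← mul_assoc, hA, mul_assoc]
      add_mem' := fun {A B} hA hB γ => by rw [add_mul, mul_add, hA, hB]
      algebraMap_mem' := fun c γ => Algebra.commutes c _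
      star_mem' := fun {A} hA γ => by
        have h := congrArg star (hA γ⁻¹)
        rw [star_mul, star_mul, star_leftMulL, inv_inv] at h
        exact h.symm }
  centralizer_centralizer' := by
    have h : {A : GroupL2 Γ →L[ℂ] GroupL2 Γ | ∀ γ : Γ, A * leftMulL γ = leftMulL γ * A}
        = Set.centralizer (Set.range (leftMulL (Γ := Γ))) := by
      ext A
      simp [Set.mem_centralizer_iff, eq_comm]
    change Set.centralizer (Set.centralizer
      {A : GroupL2 Γ →L[ℂ] GroupL2 Γ | ∀ γ : Γ, A * leftMulL γ = leftMulL γ * A}) = _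
    rw [h, Set.centralizer_centralizer_centralizer]

theorem mem_groupVonNeumannAlgebra_iff {Γ : Type*} [Group Γ] {A : GroupL2 Γ →L[ℂ] GroupL2 Γ} :
    A ∈ groupVonNeumannAlgebra Γ ↔
      ∀ (γ : Γ) (x : GroupL2 Γ), A (leftMulL γ x) = leftMulL γ (A x) :=
  forall_congr' fun _ => ContinuousLinearMap.ext_iff

/-- The canonical trace `τ(A) = (A e, e)`. -/
def groupTrace (Γ : Type*) [Group Γ] : (GroupL2 Γ →L[ℂ] GroupL2 Γ) → ℂ :=
  vectorTrace (basisVec (1 : Γ))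

/-- The Fuglede--Kadison determinant `det_{𝓝Γ} A` (used for `A ∈ 𝓝Γ`). -/
def groupDet {Γ : Type*} [Group Γ] (A : GroupL2 Γ →L[ℂ] GroupL2 Γ) : ℝ :=
  fkDet (groupTrace Γ) A

/-- The subspace `ℂF ⊂ L²(Γ)` spanned by the finite set `F ⊂ Γ`. -/
def finsetSpan {Γ : Type*} (F : Finset Γ) : Submodule ℂ (GroupL2 Γ) :=
  Submodule.span ℂ (basisVec '' (F : Set Γ))

instance {Γ : Type*} (F : Finset Γ) : FiniteDimensional ℂ (finsetSpan F) :=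
  FiniteDimensional.span_of_finite ℂ (F.finite_toSet.image _)

/-- The compression `A_F = p_F A i_F` of `A` to an endomorphism of `ℂF`, where `i_F` is the
inclusion and `p_F` the orthogonal projection. -/
def compression {Γ : Type*} (A : GroupL2 Γ →L[ℂ] GroupL2 Γ) (F : Finset Γ) :
    finsetSpan F →ₗ[ℂ] finsetSpan F :=
  ((finsetSpan F).orthogonalProjectionOnto ∘L A ∘L (finsetSpan F).subtypeL).toLinearMap

open scoped ComplexOrder in
/-- For positive `A` the determinant of `A_F` is a non-negative real number. -/
theorem det_compression_nonneg {Γ : Type*} {A : GroupL2 Γ →L[ℂ] GroupL2 Γ} (hA : A.IsPositive)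
    (F : Finset Γ) : 0 ≤ LinearMap.det (compression A F) := by
  have hp : (compression A F).IsPositive :=
    (hA.orthogonalProjectionOnto_comp (finsetSpan F)).toLinearMap
  rw [hp.isSymmetric.det_eq_prod_eigenvalues rfl]
  exact Finset.prod_nonneg fun i _ => Complex.zero_le_real.mpr (hp.nonneg_eigenvalues rfl i)

open Classical in
/-- A (right) Følner sequence in `Γ`: non-empty finite subsets `F n` with
`|F_n γ \ F_n| / |F_n| → 0` for every `γ`. -/
structure IsFolnerSeq {Γ : Type*} [Group Γ] (F : ℕ → Finset Γ) : Prop where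
  nonempty : ∀ n, (F n).Nonempty
  tendsto : ∀ γ : Γ, Tendsto
    (fun n => (((F n).image (· * γ) \ F n).card : ℝ) / ((F n).card : ℝ)) atTop (𝓝 0)

end GroupVonNeumann

/-! For a polynomial `P`, the normalised traces `tr P(A_F) / |F|` converge to `τ(P(A))` along a
Følner sequence. Indeed `tr p_F A^k i_F = |F| τ(A^k)` by equivariance, and replacing `p_F A^k i_F`
by `(A_F)^k` costs at most a constant times the sum over `g ∈ F` of the length of the part of `A g`
outside `ℂF`. The Følner condition makes this sum `o(|F|)` (`tendsto_trace_pow_div_card`).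

The eigenvalues of `A_F` lie in `[0, ‖A‖]`. If `x ≤ exp (P x)` there, multiplying over the
eigenvalues gives `det A_F ≤ exp (tr P(A_F))`, hence `limsup (det A_F)^{1/|F|} ≤ exp τ(P(A))`
(`limsup_det_compression_le`). By Weierstrass, `P` can be taken between `log (x + ε)` and `log (x +
ε) + δ`; then let `δ → 0` and `ε → 0`. The argument is one-sided: polynomials bound `log` from above
near `0`, but cannot follow it to `-∞`. -/

/-! ### Traces of compressions to a finite-dimensional subspace -/

section CompressionTrace

variable {H : Type*} [NormedAddCommGroup H] [InnerProductSpace ℂ H]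

/-- The compression of a bounded operator to a finite-dimensional subspace. -/
noncomputable def subspaceCompression (K : Submodule ℂ H) [FiniteDimensional ℂ K] (X : H →L[ℂ] H) :
    K →L[ℂ] K :=
  K.orthogonalProjectionOnto ∘L X ∘L K.subtypeL

variable {K : Submodule ℂ H} {ι : Type*} [Fintype ι]

theorem norm_trace_comp_le (b : OrthonormalBasis ι ℂ K) (T : K →L[ℂ] H) (Z : H →L[ℂ] K) :
    ‖LinearMap.trace ℂ K (Z ∘L T).toLinearMap‖ ≤ ‖Z‖ * ∑ i, ‖T (b i)‖ := by
  rw [LinearMap.trace_eq_sum_inner _ b, Finset.mul_sum]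
  refine (norm_sum_le _ _).trans (Finset.sum_le_sum fun i _ => ?_)
  calc ‖inner ℂ (b i) (Z (T (b i)))‖ ≤ ‖b i‖ * ‖Z (T (b i))‖ := norm_inner_le_norm _ _
    _ = ‖Z (T (b i))‖ := by rw [b.norm_eq_one, one_mul]
    _ ≤ ‖Z‖ * ‖T (b i)‖ := Z.le_opNorm _

variable [FiniteDimensional ℂ K]

theorem norm_subspaceCompression_le (X : H →L[ℂ] H) : ‖subspaceCompression K X‖ ≤ ‖X‖ := by
  refine ContinuousLinearMap.opNorm_le_bound _ (norm_nonneg _) fun v => ?_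
  calc ‖K.orthogonalProjectionOnto (X v)‖ ≤ ‖X v‖ := K.norm_orthogonalProjectionOnto_apply_le _
    _ ≤ ‖X‖ * ‖v‖ := X.le_opNorm _

/-- Split the identity between `X` and `A` as the projection to `K` plus its complement; the error
term sees only the part of `A` that leaves `K`. -/
theorem subspaceCompression_mul (X A : H →L[ℂ] H) :
    subspaceCompression K (X * A) = subspaceCompression K X * subspaceCompression K A +
      K.orthogonalProjectionOnto ∘L X ∘L
        (A ∘L K.subtypeL - K.subtypeL ∘L subspaceCompression K A) := by
  ext v
  simp [subspaceCompression]

/-- The traces of the compression of a power and of the power of a compression differ at most by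
a multiple of the failure of `A` to map the subspace into itself. -/
theorem norm_trace_compression_pow_sub_le (b : OrthonormalBasis ι ℂ K) (A : H →L[ℂ] H) {M : ℝ}
    (hM : ‖A‖ ≤ M) (hM1 : 1 ≤ M) (k : ℕ) (Y : K →L[ℂ] K) :
    ‖LinearMap.trace ℂ K (Y * subspaceCompression K (A ^ k)).toLinearMap -
        LinearMap.trace ℂ K (Y * subspaceCompression K A ^ k).toLinearMap‖ ≤
      ‖Y‖ * (k * M ^ k) * ∑ i, ‖A (b i) - K.orthogonalProjectionOnto (A (b i))‖ := by
  have hM0 : 0 ≤ M := zero_le_one.trans hM1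
  set S := ∑ i, ‖A (b i) - K.orthogonalProjectionOnto (A (b i))‖ with hS
  have hS0 : 0 ≤ S := Finset.sum_nonneg fun _ _ => norm_nonneg _
  have hpow : ∀ j : ℕ, ‖A ^ j‖ ≤ M ^ j := by
    intro j
    induction j with
    | zero =>
      rw [pow_zero, pow_zero]
      exact ContinuousLinearMap.norm_id_le
    | succ j ih =>
      rw [pow_succ, pow_succ]
      exact (norm_mul_le _ _).trans (by gcongr)
  have hcomm : ∀ U V : K →L[ℂ] K, LinearMap.trace ℂ K (U * V).toLinearMap =
      LinearMap.trace ℂ K (V * U).toLinearMap := fun U V =>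
    LinearMap.trace_mul_comm ℂ U.toLinearMap V.toLinearMap
  -- Cyclicity of the trace moves each factor peeled off the power into `Y`, so `Y` must vary.
  induction k generalizing Y with
  | zero =>
    have : subspaceCompression K (1 : H →L[ℂ] H) = 1 := by
      ext v
      simp [subspaceCompression]
    simp [this]
  | succ k ih =>
    set C := subspaceCompression K A with hC
    have h1 : LinearMap.trace ℂ K (Y * subspaceCompression K (A ^ (k + 1))).toLinearMap =
        LinearMap.trace ℂ K (C * Y * subspaceCompression K (A ^ k)).toLinearMap +
        LinearMap.trace ℂ K ((Y ∘L K.orthogonalProjectionOnto ∘L (A ^ k)) ∘L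
          (A ∘L K.subtypeL - K.subtypeL ∘L C)).toLinearMap := by
      rw [mul_assoc C, hcomm C, pow_succ, subspaceCompression_mul, mul_add, mul_assoc,
        ContinuousLinearMap.toLinearMap_add, map_add]
      rfl
    have h2 : LinearMap.trace ℂ K (Y * C ^ (k + 1)).toLinearMap =
        LinearMap.trace ℂ K (C * Y * C ^ k).toLinearMap := by
      rw [mul_assoc C, hcomm C, pow_succ, mul_assoc]
    have h3 := norm_trace_comp_le b (A ∘L K.subtypeL - K.subtypeL ∘L C)
      (Y ∘L K.orthogonalProjectionOnto ∘L (A ^ k))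
    have h4 : ‖Y ∘L K.orthogonalProjectionOnto ∘L (A ^ k)‖ ≤ ‖Y‖ * M ^ k := by
      refine (ContinuousLinearMap.opNorm_comp_le _ _).trans ?_
      gcongr
      refine (ContinuousLinearMap.opNorm_comp_le _ _).trans ?_
      refine (mul_le_mul K.orthogonalProjectionOnto_norm_le (hpow k) (norm_nonneg _)
        zero_le_one).trans (one_mul _).le
    have h5 : ‖C * Y‖ ≤ M * ‖Y‖ :=
      (norm_mul_le C Y).trans (mul_le_mul_of_nonneg_right
        ((norm_subspaceCompression_le A).trans hM) (norm_nonneg Y))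
    rw [h1, h2, add_sub_right_comm]
    refine (norm_add_le _ _).trans ?_
    calc _ ≤ ‖C * Y‖ * (k * M ^ k) * S + ‖Y ∘L K.orthogonalProjectionOnto ∘L (A ^ k)‖ * S :=
          add_le_add (ih _) h3
      _ ≤ (M * ‖Y‖) * (k * M ^ k) * S + (‖Y‖ * M ^ k) * S := by gcongr
      -- Since `1 ≤ M`, both terms become multiples of `M ^ (k + 1)`, with coefficients `k` and `1`.
      _ ≤ (M * ‖Y‖) * (k * M ^ k) * S + (‖Y‖ * (M ^ k * M)) * S := by
          gcongr
          exact le_mul_of_one_le_right (by positivity) hM1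
      _ = _ := by push_cast; ring

end CompressionTrace

/-! ### Coordinates in `L²(Γ)` and the orthonormal basis of `ℂF` -/

namespace GroupL2

variable {Γ : Type*}

theorem inner_basisVec_left (g : Γ) (x : GroupL2 Γ) : inner ℂ (basisVec g) x = x g := by
  classical
  unfold basisVec
  rw [lp.inner_single_left]
  simp

theorem basisVec_apply [DecidableEq Γ] (g h : Γ) :
    (basisVec g : GroupL2 Γ) h = if h = g then 1 else 0 := by
  simp only [basisVec, lp.single_apply, Pi.single_apply]
  congr

theorem orthonormal_basisVec : Orthonormal ℂ (basisVec : Γ → GroupL2 Γ) := by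
  classical
  rw [orthonormal_iff_ite]
  intro g h
  rw [inner_basisVec_left, basisVec_apply]

theorem norm_sq_eq_tsum (x : GroupL2 Γ) : ‖x‖ ^ 2 = ∑' h, ‖x h‖ ^ 2 := by
  simpa using lp.norm_rpow_eq_tsum (p := 2) (by norm_num) x

theorem summable_norm_sq (x : GroupL2 Γ) : Summable fun h => ‖x h‖ ^ 2 := by
  simpa using (memℓp_gen_iff (p := 2) (by norm_num)).mp (lp.memℓp x)

end GroupL2

open GroupL2

section FinsetSpan

variable {Γ : Type*}

theorem basisVec_mem_finsetSpan {F : Finset Γ} {g : Γ} (hg : g ∈ F) :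
    basisVec g ∈ finsetSpan F :=
  Submodule.subset_span ⟨g, hg, rfl⟩

theorem orthonormal_basisVec_finsetSpan (F : Finset Γ) :
    Orthonormal ℂ (fun g : F => (⟨basisVec (g : Γ), basisVec_mem_finsetSpan g.2⟩ : finsetSpan F)) :=
  have h := orthonormal_basisVec.comp (fun g : F => (g : Γ)) Subtype.val_injective
  ⟨fun g => h.1 g, fun _ _ hgh => h.2 hgh⟩

theorem top_le_span_basisVec_finsetSpan (F : Finset Γ) :
    ⊤ ≤ Submodule.span ℂ (Set.range fun g : F =>
      (⟨basisVec (g : Γ), basisVec_mem_finsetSpan g.2⟩ : finsetSpan F)) := by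
  rw [← Submodule.map_le_map_iff_of_injective (finsetSpan F).injective_subtype,
    Submodule.map_span, Submodule.map_top, Submodule.range_subtype]
  refine Submodule.span_mono ?_
  rintro _ ⟨g, hg, rfl⟩
  exact ⟨_, ⟨⟨g, hg⟩, rfl⟩, rfl⟩

/-- The orthonormal basis of `ℂF` given by the elements of `F`. -/
noncomputable def finsetSpanBasis (F : Finset Γ) : OrthonormalBasis F ℂ (finsetSpan F) :=
  OrthonormalBasis.mk (orthonormal_basisVec_finsetSpan F) (top_le_span_basisVec_finsetSpan F)

theorem coe_finsetSpanBasis {F : Finset Γ} (g : F) :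
    (finsetSpanBasis F g : GroupL2 Γ) = basisVec (g : Γ) := by
  rw [finsetSpanBasis, OrthonormalBasis.coe_mk]

open Classical in
theorem sub_orthogonalProjectionOnto_finsetSpan_apply (F : Finset Γ) (x : GroupL2 Γ) (h : Γ) :
    (x - (finsetSpan F).orthogonalProjectionOnto x : GroupL2 Γ) h = if h ∈ F then 0 else x h := by
  split_ifs with hh
  · rw [← inner_basisVec_left]
    exact (finsetSpan F).sub_starProjection_mem_orthogonal x _ (basisVec_mem_finsetSpan hh)
  · have hle : finsetSpan F ≤ LinearMap.ker (innerSL ℂ (basisVec h)).toLinearMap := by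
      refine Submodule.span_le.mpr ?_
      rintro _ ⟨g, hg, rfl⟩
      have : h ≠ g := fun e => hh (e ▸ hg)
      simp [inner_basisVec_left, basisVec_apply, this]
    have h0 : (((finsetSpan F).orthogonalProjectionOnto x : finsetSpan F) : GroupL2 Γ) h = 0 := by
      rw [← inner_basisVec_left]
      exact hle ((finsetSpan F).orthogonalProjectionOnto x).2
    rw [lp.coeFn_sub, Pi.sub_apply, h0, sub_zero]

end FinsetSpan

/-! ### Convergence of normalised traces along a Følner sequence -/

section Folner

variable {Γ : Type*} [Group Γ] {A : GroupL2 Γ →L[ℂ] GroupL2 Γ}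

theorem map_basisVec_apply (hA : A ∈ groupVonNeumannAlgebra Γ) (g h : Γ) :
    A (basisVec g) h = A (basisVec 1) (g⁻¹ * h) := by
  have := mem_groupVonNeumannAlgebra_iff.mp hA g (basisVec 1)
  rw [leftMulL_basisVec, mul_one] at this
  rw [this, leftMulL_apply]

/-- By left equivariance all diagonal matrix coefficients of `A` equal `τ(A)`. -/
theorem trace_subspaceCompression_finsetSpan (hA : A ∈ groupVonNeumannAlgebra Γ) (F : Finset Γ) :
    LinearMap.trace ℂ (finsetSpan F) (subspaceCompression (finsetSpan F) A).toLinearMap =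
      F.card * groupTrace Γ A := by
  rw [LinearMap.trace_eq_sum_inner _ (finsetSpanBasis F)]
  have : ∀ g : F, inner ℂ (finsetSpanBasis F g)
      ((subspaceCompression (finsetSpan F) A).toLinearMap (finsetSpanBasis F g)) =
      groupTrace Γ A := by
    intro g
    change inner ℂ (finsetSpanBasis F g)
      ((finsetSpan F).orthogonalProjectionOnto (A (finsetSpanBasis F g))) = _
    rw [Submodule.inner_orthogonalProjectionOnto_eq_of_mem_left, coe_finsetSpanBasis,
      inner_basisVec_left, map_basisVec_apply hA, inv_mul_cancel, groupTrace, vectorTrace,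
      inner_basisVec_left]
  rw [Finset.sum_congr rfl fun g _ => this g]
  simp

-- The coefficient of `A g` at `gγ` is that of `A e` at `γ`, and it counts exactly when `gγ ∉ F`.
-- Summing over `g` first, `γ` occurs `|Fγ \ F|` times.
open Classical in
theorem sum_norm_sq_defect_eq (hA : A ∈ groupVonNeumannAlgebra Γ) (F : Finset Γ) :
    ∑ g ∈ F, ‖A (basisVec g) - (finsetSpan F).orthogonalProjectionOnto (A (basisVec g))‖ ^ 2 =
      ∑' γ, ((F.image (· * γ) \ F).card : ℝ) * ‖A (basisVec 1) γ‖ ^ 2 := by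
  have h1 : ∀ g : Γ,
      ‖A (basisVec g) - (finsetSpan F).orthogonalProjectionOnto (A (basisVec g))‖ ^ 2 =
      ∑' γ, if g * γ ∈ F then 0 else ‖A (basisVec 1) γ‖ ^ 2 := by
    intro g
    rw [norm_sq_eq_tsum, ← (Equiv.mulLeft g).tsum_eq]
    refine tsum_congr fun γ => ?_
    rw [sub_orthogonalProjectionOnto_finsetSpan_apply, Equiv.coe_mulLeft, map_basisVec_apply hA,
      inv_mul_cancel_left]
    split_ifs <;> simp
  have h2 : ∀ g ∈ F, Summable fun γ => if g * γ ∈ F then 0 else ‖A (basisVec 1) γ‖ ^ 2 := by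
    intro g _
    refine Summable.of_nonneg_of_le (fun γ => ?_) (fun γ => ?_) (summable_norm_sq (A (basisVec 1)))
    · split_ifs <;> positivity
    · split_ifs <;> first | exact le_rfl | positivity
  simp_rw [h1]
  rw [← Summable.tsum_finsetSum h2]
  refine tsum_congr fun γ => ?_
  have h3 : (F.image (· * γ) \ F).card = (F.filter fun g => g * γ ∉ F).card := by
    rw [← Finset.card_image_of_injective (F.filter fun g => g * γ ∉ F) (mul_left_injective γ)]
    congr 1
    ext h
    simp only [Finset.mem_sdiff, Finset.mem_image, Finset.mem_filter]
    constructor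
    · rintro ⟨⟨g, hg, rfl⟩, hn⟩
      exact ⟨g, ⟨hg, hn⟩, rfl⟩
    · rintro ⟨g, ⟨hg, hn⟩, rfl⟩
      exact ⟨⟨g, hg, rfl⟩, hn⟩
  rw [h3, ← nsmul_eq_mul, ← Finset.sum_const, Finset.sum_filter]
  refine Finset.sum_congr rfl fun g _ => ?_
  by_cases h : g * γ ∈ F <;> simp [h]

theorem tendsto_sum_norm_defect_div_card {F : ℕ → Finset Γ} (hF : IsFolnerSeq F)
    (hA : A ∈ groupVonNeumannAlgebra Γ) :
    Tendsto (fun n => (∑ g ∈ F n,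
        ‖A (basisVec g) - (finsetSpan (F n)).orthogonalProjectionOnto (A (basisVec g))‖) /
          ((F n).card : ℝ)) atTop (𝓝 0) := by
  classical
  have hsq : Tendsto (fun n => (∑ g ∈ F n,
      ‖A (basisVec g) - (finsetSpan (F n)).orthogonalProjectionOnto (A (basisVec g))‖ ^ 2) /
        ((F n).card : ℝ)) atTop (𝓝 0) := by
    have h : Tendsto (fun n => ∑' γ, (((F n).image (· * γ) \ F n).card : ℝ) / ((F n).card : ℝ) *
        ‖A (basisVec 1) γ‖ ^ 2) atTop (𝓝 (∑' γ : Γ, 0 * ‖A (basisVec 1) γ‖ ^ 2)) := by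
      -- The Følner ratios are at most `1`, so the square-summable coefficients of `A e` dominate.
      refine tendsto_tsum_of_dominated_convergence (summable_norm_sq (A (basisVec 1)))
        (fun γ => ?_) (Eventually.of_forall fun n γ => ?_)
      · refine Tendsto.mul_const _ ?_
        convert hF.tendsto γ
      · rw [Real.norm_of_nonneg (by positivity)]
        refine mul_le_of_le_one_left (by positivity) (div_le_one_of_le₀ ?_ (by positivity))
        exact_mod_cast (Finset.card_le_card Finset.sdiff_subset).trans Finset.card_image_le
    simp only [zero_mul, tsum_zero] at h
    refine h.congr fun n => ?_
    rw [sum_norm_sq_defect_eq hA, div_eq_inv_mul, ← tsum_mul_left]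
    exact tsum_congr fun γ => by ring
  -- Cauchy–Schwarz: the mean of the norms is at most the root of the mean of their squares.
  have hsqrt := (Real.continuous_sqrt.tendsto 0).comp hsq
  rw [Real.sqrt_zero] at hsqrt
  refine squeeze_zero (fun n => by positivity) (fun n => ?_) hsqrt
  refine Real.le_sqrt_of_sq_le ?_
  have hc : (0 : ℝ) < (F n).card := by exact_mod_cast (hF.nonempty n).card_pos
  rw [div_pow, div_le_div_iff₀ (by positivity) hc]
  have := sq_sum_le_card_mul_sum_sq (s := F n) (f := fun g =>
    ‖A (basisVec g) - (finsetSpan (F n)).orthogonalProjectionOnto (A (basisVec g))‖)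
  nlinarith

theorem tendsto_trace_pow_div_card {F : ℕ → Finset Γ} (hF : IsFolnerSeq F)
    (hA : A ∈ groupVonNeumannAlgebra Γ) (k : ℕ) :
    Tendsto (fun n => LinearMap.trace ℂ (finsetSpan (F n)) (compression A (F n) ^ k) /
      ((F n).card : ℂ)) atTop (𝓝 (groupTrace Γ (A ^ k))) := by
  set M := max 1 ‖A‖
  have h0 := (tendsto_sum_norm_defect_div_card hF hA).const_mul (k * M ^ k)
  rw [mul_zero] at h0
  rw [tendsto_iff_norm_sub_tendsto_zero]
  refine squeeze_zero (fun _ => norm_nonneg _) (fun n => ?_) h0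
  have hc : (0 : ℝ) < (F n).card := by exact_mod_cast (hF.nonempty n).card_pos
  have hc' : ((F n).card : ℂ) ≠ 0 := by exact_mod_cast hc.ne'
  have hpow : compression A (F n) ^ k =
      (1 * subspaceCompression (finsetSpan (F n)) A ^ k).toLinearMap := by
    rw [one_mul]
    exact (ContinuousLinearMap.toLinearMap_pow (subspaceCompression (finsetSpan (F n)) A) k).symm
  have h1 := norm_trace_compression_pow_sub_le (finsetSpanBasis (F n)) A (le_max_right 1 ‖A‖)
    (le_max_left 1 ‖A‖) k 1
  rw [← hpow, one_mul, trace_subspaceCompression_finsetSpan (pow_mem hA k), norm_sub_rev] at h1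
  simp only [coe_finsetSpanBasis] at h1
  rw [Finset.sum_coe_sort (F n) fun g =>
    ‖A (basisVec g) - (finsetSpan (F n)).orthogonalProjectionOnto (A (basisVec g))‖] at h1
  have h2 : ‖(1 : finsetSpan (F n) →L[ℂ] finsetSpan (F n))‖ ≤ 1 := ContinuousLinearMap.norm_id_le
  rw [div_sub' hc', norm_div, Complex.norm_natCast, ← mul_div_assoc]
  gcongr
  refine h1.trans (mul_le_mul_of_nonneg_right ?_ (by positivity))
  exact mul_le_of_le_one_left (by positivity) h2

theorem tendsto_trace_aeval_div_card {F : ℕ → Finset Γ} (hF : IsFolnerSeq F)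
    (hA : A ∈ groupVonNeumannAlgebra Γ) (P : Polynomial ℂ) :
    Tendsto (fun n => LinearMap.trace ℂ (finsetSpan (F n))
      (Polynomial.aeval (compression A (F n)) P) / ((F n).card : ℂ)) atTop
      (𝓝 (groupTrace Γ (Polynomial.aeval A P))) := by
  induction P using Polynomial.induction_on' with
  | add P Q hP hQ =>
    have h : groupTrace Γ (Polynomial.aeval A (P + Q)) =
        groupTrace Γ (Polynomial.aeval A P) + groupTrace Γ (Polynomial.aeval A Q) := by
      simp [groupTrace, vectorTrace]
    rw [h]
    refine (hP.add hQ).congr fun n => ?_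
    rw [map_add, map_add, add_div]
  | monomial k a =>
    have h : groupTrace Γ (Polynomial.aeval A (Polynomial.monomial k a)) =
        a * groupTrace Γ (A ^ k) := by
      rw [Polynomial.aeval_monomial, ← Algebra.smul_def]
      simp [groupTrace, vectorTrace]
    rw [h]
    refine ((tendsto_trace_pow_div_card hF hA k).const_mul a).congr fun n => ?_
    rw [Polynomial.aeval_monomial, ← Algebra.smul_def, map_smul, smul_eq_mul, mul_div_assoc]

end Folner


/-! ### Bounding determinants by traces of polynomials -/

/-- Both sides are products over one eigenbasis, compared factor by factor. The hypothesis is in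
exponential form because `Real.log 0 = 0` would impose `0 ≤ P 0`, which fails for approximants of
`log (x + ε)` with small `ε`. -/
theorem LinearMap.IsPositive.det_re_le_exp_trace {E : Type*} [NormedAddCommGroup E]
    [InnerProductSpace ℂ E] [FiniteDimensional ℂ E] {T : E →ₗ[ℂ] E} (hT : T.IsPositive) {M : ℝ}
    (hM : ∀ v, ‖T v‖ ≤ M * ‖v‖) (P : Polynomial ℝ)
    (hP : ∀ x ∈ Set.Icc 0 M, x ≤ Real.exp (P.eval x)) :
    (LinearMap.det T).re ≤ Real.exp
      (LinearMap.trace ℂ E (Polynomial.aeval T (P.map (algebraMap ℝ ℂ)))).re := by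
  have hs := hT.isSymmetric
  set μ := hs.eigenvalues rfl
  set b := hs.eigenvectorBasis rfl
  have htr : LinearMap.trace ℂ E (Polynomial.aeval T (P.map (algebraMap ℝ ℂ))) =
      ∑ i, ((P.eval (μ i) : ℝ) : ℂ) := by
    rw [LinearMap.trace_eq_sum_inner _ b]
    refine Finset.sum_congr rfl fun i _ => ?_
    rw [Module.End.aeval_apply_of_hasEigenvector (hs.hasEigenvector_eigenvectorBasis rfl i),
      inner_smul_right, inner_self_eq_norm_sq_to_K, b.norm_eq_one]
    have : Polynomial.eval ((μ i : ℝ) : ℂ) (P.map (algebraMap ℝ ℂ)) = ((P.eval (μ i) : ℝ) : ℂ) := by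
      rw [← Complex.coe_algebraMap, Polynomial.eval_map_apply]
    simpa using this
  have hdet : LinearMap.det T = ((∏ i, μ i : ℝ) : ℂ) := by
    rw [hs.det_eq_prod_eigenvalues rfl, Complex.ofReal_prod]
    rfl
  rw [htr, hdet, ← Complex.ofReal_sum, Complex.ofReal_re, Complex.ofReal_re, Real.exp_sum]
  refine Finset.prod_le_prod (fun i _ => hT.nonneg_eigenvalues rfl i) fun i _ => hP _ ?_
  refine ⟨hT.nonneg_eigenvalues rfl i, ?_⟩
  have h := hM (b i)
  rw [hs.apply_eigenvectorBasis rfl i, norm_smul, b.norm_eq_one, mul_one, mul_one] at h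
  exact (le_abs_self _).trans (by simpa using h)

section

variable {Γ : Type*} {A : GroupL2 Γ →L[ℂ] GroupL2 Γ}

theorem det_compression_rpow_le (hpos : A.IsPositive) (F : Finset Γ) (P : Polynomial ℝ)
    (hP : ∀ x ∈ Set.Icc 0 ‖A‖, x ≤ Real.exp (P.eval x)) :
    (LinearMap.det (compression A F)).re ^ (1 / (F.card : ℝ)) ≤
      Real.exp (LinearMap.trace ℂ (finsetSpan F)
        (Polynomial.aeval (compression A F) (P.map (algebraMap ℝ ℂ))) / (F.card : ℂ)).re := by
  have hp : (compression A F).IsPositive :=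
    (hpos.orthogonalProjectionOnto_comp (finsetSpan F)).toLinearMap
  have hle := hp.det_re_le_exp_trace (M := ‖A‖) (fun v =>
    ((subspaceCompression (finsetSpan F) A).le_opNorm v).trans
      (mul_le_mul_of_nonneg_right (norm_subspaceCompression_le A) (norm_nonneg v))) P hP
  have h0 : 0 ≤ (LinearMap.det (compression A F)).re :=
    (Complex.le_def.mp (det_compression_nonneg hpos F)).1
  refine (Real.rpow_le_rpow h0 hle (by positivity)).trans ?_
  rw [← Real.exp_mul, Complex.div_natCast_re, mul_one_div]

variable [Group Γ]

theorem limsup_det_compression_le {F : ℕ → Finset Γ} (hF : IsFolnerSeq F)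
    (hA : A ∈ groupVonNeumannAlgebra Γ) (hpos : A.IsPositive) (P : Polynomial ℝ)
    (hP : ∀ x ∈ Set.Icc 0 ‖A‖, x ≤ Real.exp (P.eval x)) :
    limsup (fun n => (((LinearMap.det (compression A (F n))).re ^ (1 / ((F n).card : ℝ)) : ℝ) :
      EReal)) atTop ≤ (Real.exp (groupTrace Γ (Polynomial.aeval A P)).re : ℝ) := by
  have h := tendsto_trace_aeval_div_card hF hA (P.map (algebraMap ℝ ℂ))
  rw [Polynomial.aeval_map_algebraMap] at h
  have h2 := (continuous_coe_real_ereal.tendsto _).comp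
    ((Real.continuous_exp.tendsto _).comp ((Complex.continuous_re.tendsto _).comp h))
  -- With the limit written as a limsup, the comparison is termwise; in `EReal` it needs no
  -- boundedness.
  rw [← h2.limsup_eq]
  refine limsup_le_limsup (Eventually.of_forall fun n => ?_)
  exact EReal.coe_le_coe_iff.mpr (det_compression_rpow_le hpos (F n) P hP)

end

/-! ### Functional calculus and approximation of the logarithm -/

theorem fkDetInvertible_abs_add {H : Type*} [NormedAddCommGroup H] [InnerProductSpace ℂ H]
    [CompleteSpace H] (τ : (H →L[ℂ] H) → ℂ) {A : H →L[ℂ] H} (hpos : A.IsPositive) {ε : ℝ}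
    (hε : 0 < ε) :
    fkDetInvertible τ (CFC.abs A + algebraMap ℝ (H →L[ℂ] H) ε) =
      Real.exp (τ (CFC.log (A + algebraMap ℝ (H →L[ℂ] H) ε))).re := by
  have hA0 : 0 ≤ A := (ContinuousLinearMap.nonneg_iff_isPositive A).mpr hpos
  rw [fkDetInvertible, CFC.abs_of_nonneg _ (isStrictlyPositive_abs_add A hε).nonneg,
    CFC.abs_of_nonneg A hA0]

/-- On a positive operator, a polynomial which is close to `x ↦ log (x + ε)` has almost the same
trace as `log (A + ε)`. -/
theorem re_vectorTrace_aeval_le {H : Type*} [NormedAddCommGroup H] [InnerProductSpace ℂ H]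
    [CompleteSpace H] {A : H →L[ℂ] H} (hpos : A.IsPositive) {ξ : H} (hξ : ‖ξ‖ = 1) {ε δ : ℝ}
    (hε : 0 < ε) (P : Polynomial ℝ)
    (hP : ∀ x ∈ Set.Icc 0 ‖A‖, P.eval x ≤ Real.log (x + ε) + δ) :
    (vectorTrace ξ (Polynomial.aeval A P)).re ≤
      (vectorTrace ξ (CFC.log (A + algebraMap ℝ (H →L[ℂ] H) ε))).re + δ := by
  have hA0 : 0 ≤ A := (ContinuousLinearMap.nonneg_iff_isPositive A).mpr hpos
  have hsa : IsSelfAdjoint A := hpos.isSelfAdjoint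
  have hspec : ∀ x ∈ spectrum ℝ A, x ∈ Set.Icc 0 ‖A‖ := fun x hx => by
    refine ⟨spectrum_nonneg_of_nonneg hA0 hx, (le_abs_self x).trans ?_⟩
    have := spectrum.norm_le_norm_mul_of_mem hx
    refine this.trans ((mul_le_mul_of_nonneg_left ContinuousLinearMap.norm_id_le
      (norm_nonneg _)).trans (mul_one _).le)
  have hcont : ContinuousOn (fun x : ℝ => Real.log (x + ε)) (spectrum ℝ A) := by
    refine ContinuousOn.log (by fun_prop) fun x hx => ?_
    have := (hspec x hx).1
    positivity
  have hlog : CFC.log (A + algebraMap ℝ (H →L[ℂ] H) ε) = cfc (fun x : ℝ => Real.log (x + ε)) A := by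
    have h1 : A + algebraMap ℝ (H →L[ℂ] H) ε = cfc (fun x : ℝ => x + ε) A := by
      rw [cfc_add_const ε (fun x => x) A, cfc_id' ℝ A]
    have h2 : ContinuousOn Real.log ((fun x : ℝ => x + ε) '' spectrum ℝ A) := by
      refine Real.continuousOn_log.mono ?_
      rintro _ ⟨x, hx, rfl⟩
      exact (add_pos_of_nonneg_of_pos (hspec x hx).1 hε).ne'
    rw [CFC.log, h1, ← cfc_comp' Real.log (fun x : ℝ => x + ε) A h2]
  have hle : Polynomial.aeval A P ≤
      CFC.log (A + algebraMap ℝ (H →L[ℂ] H) ε) + algebraMap ℝ (H →L[ℂ] H) δ := by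
    rw [hlog, ← cfc_polynomial P A, ← cfc_add_const δ (fun x => Real.log (x + ε)) A hcont]
    exact cfc_mono (fun x hx => hP x (hspec x hx)) P.continuous.continuousOn
      (hcont.add continuousOn_const)
  have h := ((ContinuousLinearMap.le_def _ _).mp hle).re_inner_nonneg_right ξ
  have hδ : inner ℂ ξ (algebraMap ℝ (H →L[ℂ] H) δ ξ) = (δ : ℂ) := by
    rw [Algebra.algebraMap_eq_smul_one]
    change inner ℂ ξ (δ • ξ) = _
    rw [← Complex.coe_smul, inner_smul_right, inner_self_eq_norm_sq_to_K, hξ]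
    simp
  simp only [sub_apply, add_apply, inner_sub_right, inner_add_right, hδ, map_sub, map_add] at h
  simp only [vectorTrace]
  simp only [RCLike.re_to_complex, Complex.ofReal_re] at h
  linarith

theorem exists_polynomial_log_add_approx (M : ℝ) {ε δ : ℝ} (hε : 0 < ε) (hδ : 0 < δ) :
    ∃ P : Polynomial ℝ, ∀ x ∈ Set.Icc 0 M,
      Real.log (x + ε) ≤ P.eval x ∧ P.eval x ≤ Real.log (x + ε) + δ := by
  have hcont : ContinuousOn (fun x : ℝ => Real.log (x + ε) + δ / 2) (Set.Icc 0 M) := by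
    refine ContinuousOn.add (ContinuousOn.log (by fun_prop) fun x hx => ?_) continuousOn_const
    have := hx.1
    positivity
  -- Approximating the function raised by `δ / 2` to within `δ / 2` keeps `P` above `log (x + ε)`.
  obtain ⟨P, hP⟩ := exists_polynomial_near_of_continuousOn 0 M _ hcont (δ / 2) (by positivity)
  refine ⟨P, fun x hx => ?_⟩
  have := abs_lt.mp (hP x hx)
  constructor <;> linarith [this.1, this.2]

/-! ### The determinant inequality -/

theorem proposition7 {Γ : Type*} [Group Γ] [Group.FG Γ]
    (F : ℕ → Finset Γ) (hF : IsFolnerSeq F)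
    (A : GroupL2 Γ →L[ℂ] GroupL2 Γ) (hA : A ∈ groupVonNeumannAlgebra Γ) (hpos : A.IsPositive) :
    limsup (fun n => (((LinearMap.det (compression A (F n))).re ^ (1 / ((F n).card : ℝ)) : ℝ) :
      EReal)) atTop ≤ ((groupDet A : ℝ) : EReal) := by
  have hlim := (continuous_coe_real_ereal.tendsto _).comp (tendsto_fkDet (basisVec (1 : Γ)) A)
  -- The limsup does not depend on `ε` or `δ`, so it suffices to bound it for each fixed pair, with
  -- one polynomial for all `n`.
  refine ge_of_tendsto hlim ?_
  filter_upwards [self_mem_nhdsWithin] with ε hε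
  have hε : 0 < ε := hε
  rw [Function.comp_apply, fkDetInvertible_abs_add _ hpos hε]
  set t := (vectorTrace (basisVec (1 : Γ)) (CFC.log (A + algebraMap ℝ _ ε))).re
  have hlim' : Tendsto (fun δ : ℝ => ((Real.exp (t + δ) : ℝ) : EReal)) (𝓝[>] 0)
      (𝓝 ((Real.exp t : ℝ) : EReal)) := by
    refine (continuous_coe_real_ereal.tendsto _).comp (tendsto_nhdsWithin_of_tendsto_nhds ?_)
    have : Continuous fun δ : ℝ => Real.exp (t + δ) := by fun_prop
    simpa using this.tendsto 0
  refine ge_of_tendsto hlim' ?_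
  filter_upwards [self_mem_nhdsWithin] with δ hδ
  obtain ⟨P, hP⟩ := exists_polynomial_log_add_approx ‖A‖ hε hδ
  refine (limsup_det_compression_le hF hA hpos P fun x hx => ?_).trans ?_
  · have hx0 : 0 < x + ε := add_pos_of_nonneg_of_pos hx.1 hε
    calc x ≤ x + ε := by linarith
      _ = Real.exp (Real.log (x + ε)) := (Real.exp_log hx0).symm
      _ ≤ Real.exp (P.eval x) := Real.exp_le_exp.mpr (hP x hx).1
  · refine EReal.coe_le_coe_iff.mpr (Real.exp_le_exp.mpr ?_)
    exact re_vectorTrace_aeval_le hpos (orthonormal_basisVec.1 1) hε P fun x hx => (hP x hx).2
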